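/- **Conventions.** Let $G$ be a group. For a finite symmetrized generating set $\mathcal A=\mathcal A^{-1}$ of $G$ let $\Gamma(G,\mathcal A)$ be the Cayley graph, $d$ its path metric (the word metric on $G$), and $(x|y)_w=\frac12\bigl(d(x,w)+d(y,w)-d(x,y)\bigr)$ the Gromov product. The group $G$ is *hyperbolic* if it has a finite symmetrized generating set $\mathcal A$ and a constant $\delta\ge 0$ such that $(x|y)_w\ge\min\{(x|z)_w,(y|z)_w\}-\delta$ for all $x,y,z,w\in G$. A subset $Q\subseteq G$ is *quasiconvex* if, for some finite symmetrized generating set $\mathcal A$ of $G$ (in a hyperbolic group the choice is immaterial), there is $\eta\ge 0$ such that every geodesic path in $\Gamma(G,\mathcal A)$ joining two elements of $Q$ has all its vertices at distance at most $\eta$ from $Q$. The *profinite topology* on $G$ is the topology whose basic open sets are the cosets of the normal subgroups of finite index. A hyperbolic group $G$ is *GFERF* if every quasiconvex subgroup of $G$ is closed in the profinite topology of $G$. **Theorem.** Let $G_1$ and $G_2$ be GFERF hyperbolic groups. Then the free product $G=G_1*G_2$ is also a GFERF hyperbolic group; that is, $G$ is hyperbolic and every quasiconvex subgroup of $G$ is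 closed in the profinite topology of $G$. -/

import Mathlib

open scoped Pointwise Topology

/-- `A` is a finite symmetrized generating set of the group `G`. -/
structure IsFiniteSymmGenSet {G : Type*} [Group G] (A : Set G) : Prop where
  finite : A.Finite
  symm : A⁻¹ = A
  closure_eq_top : Subgroup.closure A = ⊤

/-- The word metric on `G` with respect to `A`: the path metric on the vertices of the (right)
Cayley graph, in which `u` and `u * a` are joined by an edge for `a ∈ A`. -/
noncomputable def wordDist {G : Type*} [Group G] (A : Set G) (x y : G) : ℝ :=
  ((SimpleGraph.mulCayley A).dist x y : ℝ)

/-- The Gromov product `(x|y)_w` with respect to the word metric. -/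
noncomputable def gromovProduct {G : Type*} [Group G] (A : Set G) (x y w : G) : ℝ :=
  (1 / 2) * (wordDist A x w + wordDist A y w - wordDist A x y)

/-- A group is (word) hyperbolic if it has a finite symmetrized generating set whose word metric
satisfies Gromov's inequality for some `δ ≥ 0`. (Every point of the geometric realization of the
Cayley graph is within `1/2` of a vertex, so asking for the inequality at all points of the
realization only changes the value of `δ`.) -/
def IsHyperbolicGroup (G : Type*) [Group G] : Prop :=
  ∃ A : Set G, IsFiniteSymmGenSet A ∧ ∃ δ : ℝ, 0 ≤ δ ∧ ∀ x y z w : G,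
    min (gromovProduct A x z w) (gromovProduct A y z w) - δ ≤ gromovProduct A x y w

/-- A subset `Q` of `G` is quasiconvex with respect to `A` if for some `η ≥ 0` every geodesic
(a path in the Cayley graph whose length is the distance of its endpoints) between two elements
of `Q` stays in the closed `η`-neighbourhood of `Q`. (Including the interior points of the edges
would only change the value of `η`.) -/
def IsQuasiconvexWith {G : Type*} [Group G] (A : Set G) (Q : Set G) : Prop :=
  ∃ η : ℝ, 0 ≤ η ∧ ∀ u ∈ Q, ∀ v ∈ Q, ∀ p : (SimpleGraph.mulCayley A).Walk u v,
    p.length = (SimpleGraph.mulCayley A).dist u v →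
      ∀ x ∈ p.support, ∃ q ∈ Q, wordDist A x q ≤ η

/-- A subset is quasiconvex if it is so with respect to a finite symmetrized generating set of `G`.
(In a hyperbolic group the choice of that set is immaterial.) -/
def IsQuasiconvex {G : Type*} [Group G] (Q : Set G) : Prop :=
  ∃ A : Set G, IsFiniteSymmGenSet A ∧ IsQuasiconvexWith A Q

/-- The profinite topology on `G`, generated by the cosets of the normal subgroups of finite
index. -/
abbrev profiniteTopology (G : Type*) [Group G] : TopologicalSpace G :=
  TopologicalSpace.generateFrom
    {U : Set G | ∃ N : Subgroup G, N.Normal ∧ N.FiniteIndex ∧ ∃ g : G, U = g • (N : Set G)}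

/-- A GFERF hyperbolic group: a hyperbolic group in which every quasiconvex subgroup is closed in
the profinite topology. -/
def IsGFERFHyperbolicGroup (G : Type*) [Group G] : Prop :=
  IsHyperbolicGroup G ∧
    ∀ H : Subgroup G, IsQuasiconvex (H : Set G) → IsClosed[profiniteTopology G] (H : Set G)

/-!
The Cayley graph of `G₁ ∗ G₂` is a tree of copies of the Cayley graphs of the factors. Two distinct
points are separated by the projection to one of the copies, through which the geodesics between
them have to pass, so the four-point inequality for the copies implies that for the whole group,
with the same `δ`.

A quasiconvex subgroup `H` of the free product is finitely generated. By stability of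
quasigeodesics its conjugates are quasiconvex for the standard generators, and then, by the
pigeonhole principle, so are the intersections of the conjugates with the factors. These are the
point stabilizers of the factors acting on `(G₁ ∗ G₂) ⧸ H`, and they are closed by assumption.
Hence the action of each factor agrees on any finite set with an action moving only finitely many
points. Two such actions combine to an action of the free product, and for a suitable finite set it
has a point whose stabilizer has finite index, contains `H` and does not contain a given element
outside `H`.
-/

section GraphMetric

variable {V : Type*} {Γ : SimpleGraph V}

/-- The path metric of a connected graph, as a metric space structure on its vertices. -/
noncomputable abbrev graphMetricSpace (hΓ : Γ.Connected) : MetricSpace V where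
  dist u v := Γ.dist u v
  dist_self u := by simp
  dist_comm u v := by rw [SimpleGraph.dist_comm]
  dist_triangle u v w := mod_cast hΓ.dist_triangle
  eq_of_dist_eq_zero h := hΓ.dist_eq_zero_iff.1 (mod_cast h)

theorem dist_le_mul_graphDist {Y : Type*} [PseudoMetricSpace Y] (hΓ : Γ.Connected) {f : V → Y}
    {L : ℝ} (hf : ∀ u v, Γ.Adj u v → dist (f u) (f v) ≤ L) (u v : V) :
    dist (f u) (f v) ≤ L * Γ.dist u v := by
  obtain ⟨p, hp⟩ := hΓ.exists_walk_length_eq_dist u v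
  rw [← hp]
  clear hp
  induction p with
  | nil => simp
  | cons h p ih =>
    rw [SimpleGraph.Walk.length_cons, Nat.cast_succ, mul_add, mul_one, add_comm]
    exact (dist_triangle _ _ _).trans (add_le_add (hf _ _ h) ih)

theorem dist_add_dist_of_mem_support {u v x : V} {p : Γ.Walk u v} (hp : p.length = Γ.dist u v)
    (hx : x ∈ p.support) : Γ.dist u x + Γ.dist x v = Γ.dist u v := by
  classical
  rw [← SimpleGraph.length_eq_dist_of_subwalk hp (p.isSubwalk_takeUntil hx),
    ← SimpleGraph.length_eq_dist_of_subwalk hp (p.isSubwalk_dropUntil hx),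
    ← SimpleGraph.Walk.length_append, p.take_spec hx, hp]

/-- A finite geodesic of length `n` with integer parameters; only the values `p 0, …, p n` of the
sequence `p` matter. -/
def IsGeodesicSeq {X : Type*} [PseudoMetricSpace X] (p : ℕ → X) (n : ℕ) : Prop :=
  ∀ i j, i ≤ j → j ≤ n → dist (p i) (p j) = j - i

theorem IsGeodesicSeq.dist_add_dist {X : Type*} [PseudoMetricSpace X] {p : ℕ → X} {n : ℕ}
    (hp : IsGeodesicSeq p n) {i : ℕ} (hi : i ≤ n) :
    dist (p 0) (p i) + dist (p i) (p n) = dist (p 0) (p n) := by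
  rw [hp 0 i i.zero_le hi, hp i n hi le_rfl, hp 0 n n.zero_le le_rfl]
  ring

theorem exists_isGeodesicSeq (hΓ : Γ.Connected) {u v x : V}
    (hx : Γ.dist u x + Γ.dist x v = Γ.dist u v) :
    let := graphMetricSpace hΓ
    ∃ (p : ℕ → V) (n : ℕ), IsGeodesicSeq p n ∧ p 0 = u ∧ p n = v ∧ ∃ s ≤ n, p s = x := by
  intro
  obtain ⟨q, hq⟩ := hΓ.exists_walk_length_eq_dist u x
  obtain ⟨r, hr⟩ := hΓ.exists_walk_length_eq_dist x v
  obtain ⟨p, hxp, hp⟩ : ∃ p : Γ.Walk u v, x ∈ p.support ∧ p.length = Γ.dist u v :=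
    ⟨q.append r, by simp, by rw [SimpleGraph.Walk.length_append, hq, hr, hx]⟩
  obtain ⟨s, hs, hsp⟩ := SimpleGraph.Walk.mem_support_iff_exists_getVert.1 hxp
  refine ⟨p.getVert, p.length, fun i j hij hj => ?_, p.getVert_zero, p.getVert_length, s, hsp, hs⟩
  have hlength : ((p.drop i).take (j - i)).length = j - i := by simp; omega
  have hdist := SimpleGraph.length_eq_dist_of_subwalk hp
    (((p.drop i).isSubwalk_take (j - i)).trans (p.isSubwalk_drop i))
  rw [hlength, p.drop_getVert, Nat.add_sub_cancel' hij] at hdist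
  rw [← Nat.cast_sub hij, hdist]
  rfl

end GraphMetric

section WordMetric

open SimpleGraph

variable {G K : Type*} [Group G] [Group K] {A : Set G} {B : Set K}

theorem wordDist_mul_right_le_one (u : G) {a : G} (ha : a ∈ A) : wordDist A u (u * a) ≤ 1 := by
  rcases eq_or_ne u (u * a) with h | h
  · rw [← h]
    simp [wordDist]
  · have hadj : (mulCayley A).Adj u (u * a) := (mulCayley_adj A _ _).2 ⟨h, Or.inl (by simpa)⟩
    rw [wordDist, dist_eq_one_iff_adj.2 hadj, Nat.cast_one]

namespace IsFiniteSymmGenSet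

theorem exists_eq_mul_of_adj (hA : IsFiniteSymmGenSet A) {u v : G} (h : (mulCayley A).Adj u v) :
    ∃ a ∈ A, v = u * a := by
  refine ⟨u⁻¹ * v, ?_, by group⟩
  obtain ⟨-, h | h⟩ := (mulCayley_adj A u v).1 h
  · exact h
  · rw [← hA.symm, Set.mem_inv]
    simpa using h

theorem connected (hA : IsFiniteSymmGenSet A) : (mulCayley A).Connected := by
  have reachable_mul (g : G) : ∀ u, (mulCayley A).Reachable u (u * g) := by
    induction (hA.closure_eq_top ▸ Subgroup.mem_top g : g ∈ Subgroup.closure A) using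
      Subgroup.closure_induction with
    | mem a ha =>
      intro u
      by_cases h : u = u * a
      · rw [← h]
      · exact ((mulCayley_adj A _ _).2 ⟨h, Or.inl (by simpa)⟩).reachable
    | one => simp
    | mul x y _ _ hx hy => exact fun u => mul_assoc u x y ▸ (hx u).trans (hy _)
    | inv x _ hx => exact fun u => by simpa using (hx (u * x⁻¹)).symm
  exact ⟨fun u v => by simpa using reachable_mul (u⁻¹ * v) u⟩

/-- The word metric, as a metric space structure on the group; `dist` unfolds to `wordDist A`. -/
noncomputable abbrev metricSpace (hA : IsFiniteSymmGenSet A) : MetricSpace G :=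
  graphMetricSpace hA.connected

theorem wordDist_map_le (hA : IsFiniteSymmGenSet A) (hB : IsFiniteSymmGenSet B) {f : G → K}
    {L : ℝ} (hf : ∀ u, ∀ a ∈ A, wordDist B (f u) (f (u * a)) ≤ L) (u v : G) :
    wordDist B (f u) (f v) ≤ L * wordDist A u v := by
  let := hB.metricSpace
  refine dist_le_mul_graphDist hA.connected (f := f) (fun u v h => ?_) u v
  obtain ⟨a, ha, rfl⟩ := hA.exists_eq_mul_of_adj h
  exact hf u a ha

theorem wordDist_mul_left (hA : IsFiniteSymmGenSet A) (g u v : G) :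
    wordDist A (g * u) (g * v) = wordDist A u v := by
  have mul_left_le (g u v : G) : wordDist A (g * u) (g * v) ≤ wordDist A u v := by
    simpa using hA.wordDist_map_le hA (f := (g * ·)) (L := 1)
      (fun u a ha => by simpa [mul_assoc] using wordDist_mul_right_le_one (g * u) ha) u v
  exact (mul_left_le g u v).antisymm (by simpa using mul_left_le g⁻¹ (g * u) (g * v))

theorem wordDist_eq_wordDist_one (hA : IsFiniteSymmGenSet A) (u v : G) :
    wordDist A u v = wordDist A 1 (u⁻¹ * v) := by
  rw [← hA.wordDist_mul_left u⁻¹, inv_mul_cancel]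

theorem finite_closedBall (hA : IsFiniteSymmGenSet A) (r : ℝ) :
    {x | wordDist A 1 x ≤ r}.Finite := by
  have inv_mul_mem_pow {u v : G} (p : (mulCayley A).Walk u v) : u⁻¹ * v ∈ A ^ p.length := by
    induction p with
    | nil => simp
    | @cons u _ v h p ih =>
      obtain ⟨a, ha, rfl⟩ := hA.exists_eq_mul_of_adj h
      rw [Walk.length_cons, pow_succ']
      exact ⟨a, ha, _, ih, by group⟩
  have finite_pow (n : ℕ) : (A ^ n).Finite := by
    induction n with
    | zero => simp
    | succ n ih => exact pow_succ A n ▸ ih.mul hA.finite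
  refine ((Set.finite_Iic ⌊r⌋₊).biUnion fun n _ => finite_pow n).subset fun x hx => ?_
  obtain ⟨p, hp⟩ := hA.connected.exists_walk_length_eq_dist 1 x
  refine Set.mem_biUnion (x := p.length) (Nat.le_floor ?_) (by simpa using inv_mul_mem_pow p)
  rwa [hp]

theorem exists_wordDist_map_le (hA : IsFiniteSymmGenSet A) (hB : IsFiniteSymmGenSet B)
    (φ : G →* K) : ∃ L, 0 ≤ L ∧ ∀ u v, wordDist B (φ u) (φ v) ≤ L * wordDist A u v := by
  obtain ⟨L, hL⟩ := (hA.finite.image fun a => wordDist B 1 (φ a)).bddAbove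
  refine ⟨|L|, abs_nonneg L, hA.wordDist_map_le hB fun u a ha => ?_⟩
  rw [hB.wordDist_eq_wordDist_one, map_mul, inv_mul_cancel_left]
  exact (hL ⟨a, ha, rfl⟩).trans (le_abs_self L)

theorem wordDist_map_le_of_mapsTo (hA : IsFiniteSymmGenSet A) (hB : IsFiniteSymmGenSet B)
    {φ : G →* K} (hφ : ∀ a ∈ A, φ a ∈ insert 1 B) (u v : G) :
    wordDist B (φ u) (φ v) ≤ wordDist A u v := by
  rw [← one_mul (wordDist A u v)]
  refine hA.wordDist_map_le hB (fun u a ha => ?_) u v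
  rw [map_mul, wordDist, ← mulCayley_insert_one]
  exact wordDist_mul_right_le_one _ (hφ a ha)

theorem wordDist_map_eq_of_leftInverse (hA : IsFiniteSymmGenSet A) (hB : IsFiniteSymmGenSet B)
    {φ : G →* K} {ψ : K →* G} (hφ : ∀ a ∈ A, φ a ∈ insert 1 B) (hψ : ∀ b ∈ B, ψ b ∈ insert 1 A)
    (hψφ : Function.LeftInverse ψ φ) (u v : G) :
    wordDist B (φ u) (φ v) = wordDist A u v := by
  refine (hA.wordDist_map_le_of_mapsTo hB hφ u v).antisymm ?_
  simpa only [hψφ _] using hB.wordDist_map_le_of_mapsTo hA hψ (φ u) (φ v)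

end IsFiniteSymmGenSet

end WordMetric

section Quasiconvex

open SimpleGraph

variable {G : Type*} [Group G] {A : Set G}

theorem IsFiniteSymmGenSet.isQuasiconvexWith_iff (hA : IsFiniteSymmGenSet A) {Q : Set G} :
    IsQuasiconvexWith A Q ↔ ∃ η : ℝ, 0 ≤ η ∧ ∀ u ∈ Q, ∀ v ∈ Q, ∀ x,
      wordDist A u x + wordDist A x v = wordDist A u v → ∃ q ∈ Q, wordDist A x q ≤ η := by
  refine exists_congr fun η => and_congr_right fun _ => forall₄_congr fun u _ v _ => ?_
  constructor
  · intro hQ x hx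
    obtain ⟨p, hp⟩ := hA.connected.exists_walk_length_eq_dist u x
    obtain ⟨q, hq⟩ := hA.connected.exists_walk_length_eq_dist x v
    refine hQ (p.append q) ?_ x (by simp)
    rw [Walk.length_append, hp, hq]
    unfold wordDist at hx
    exact_mod_cast hx
  · intro hQ p hp x hx
    refine hQ x ?_
    unfold wordDist
    exact_mod_cast dist_add_dist_of_mem_support hp hx

end Quasiconvex

section FourPoint

variable {X : Type*}

/-- The four-point inequality for the distance function `d`, which is Gromov's inequality for the
Gromov product with the base point moved to the end of the list. -/
def FourPoint (d : X → X → ℝ) (δ : ℝ) (x y z w : X) : Prop :=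
  d x y + d z w ≤ max (d x z + d y w) (d x w + d y z) + 2 * δ

/-- Gromov hyperbolicity, with constant `δ`, of the distance function `d`. -/
def IsGromovHyperbolic (d : X → X → ℝ) (δ : ℝ) : Prop :=
  ∀ x y z w, FourPoint d δ x y z w

theorem fourPoint_iff {d : X → X → ℝ} {δ : ℝ} {x y z w : X} :
    FourPoint d δ x y z w ↔
      d x y + d z w ≤ d x z + d y w + 2 * δ ∨ d x y + d z w ≤ d x w + d y z + 2 * δ := by
  rw [FourPoint, ← max_add_add_right, le_max_iff]

theorem IsGromovHyperbolic.mono {d : X → X → ℝ} {δ δ' : ℝ} (h : IsGromovHyperbolic d δ)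
    (hδ : δ ≤ δ') : IsGromovHyperbolic d δ' :=
  fun x y z w => (h x y z w).trans (by gcongr)

theorem IsGromovHyperbolic.nonneg [PseudoMetricSpace X] [Nonempty X] {δ : ℝ}
    (h : IsGromovHyperbolic (X := X) dist δ) : 0 ≤ δ := by
  inhabit X
  simpa [FourPoint] using h default default default default

theorem isHyperbolicGroup_iff {G : Type*} [Group G] :
    IsHyperbolicGroup G ↔
      ∃ A : Set G, IsFiniteSymmGenSet A ∧ ∃ δ, IsGromovHyperbolic (wordDist A) δ := by
  have gromov_iff (A : Set G) (δ : ℝ) (x y z w : G) :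
      min (gromovProduct A x z w) (gromovProduct A y z w) - δ ≤ gromovProduct A x y w ↔
        FourPoint (wordDist A) δ x y z w := by
    rw [fourPoint_iff, sub_le_iff_le_add, min_le_iff]
    unfold gromovProduct
    constructor <;> rintro (h | h)
    exacts [.inl (by linarith), .inr (by linarith), .inl (by linarith), .inr (by linarith)]
  simp only [IsHyperbolicGroup, gromov_iff]
  refine exists_congr fun A => and_congr_right fun hA => exists_congr fun δ =>
    and_iff_right_of_imp fun h => ?_
  let := hA.metricSpace
  exact IsGromovHyperbolic.nonneg h

end FourPoint

section Gate

variable {X : Type*} [PseudoMetricSpace X] {δ : ℝ}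

/-- A projection `π` such that every geodesic between points with different projections passes
through both projections: in a tree of spaces, this is the nearest-point projection to a piece. -/
structure IsGateProjection (π : X → X) : Prop where
  idem : ∀ x, π (π x) = π x
  dist_eq_add : ∀ ⦃x y⦄, π x ≠ π y → dist x y = dist x (π x) + dist (π x) y

theorem FourPoint.of_gate {x y z w q : X} (h : FourPoint dist δ x y z q)
    (hx : dist x w = dist x q + dist q w) (hy : dist y w = dist y q + dist q w)
    (hz : dist z w = dist z q + dist q w) : FourPoint dist δ x y z w := by
  rw [fourPoint_iff] at h ⊢
  rw [hx, hy, hz]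
  exact h.imp (by intro; linarith) (by intro; linarith)

theorem FourPoint.swap_left_right {x y z w : X} (h : FourPoint dist δ x y z w) :
    FourPoint dist δ y x w z := by
  simpa only [FourPoint, dist_comm, add_comm] using h

theorem FourPoint.swap_pairs {x y z w : X} (h : FourPoint dist δ x y z w) :
    FourPoint dist δ z w x y := by
  simpa only [FourPoint, dist_comm, add_comm] using h

namespace IsGateProjection

variable {π : X → X}

theorem dist_eq (hπ : IsGateProjection π) {x y : X} (hxy : π x ≠ π y) :
    dist x y = dist x (π x) + dist (π x) (π y) + dist y (π y) := by
  have hyx : dist y (π x) = dist y (π y) + dist (π y) (π x) :=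
    hπ.dist_eq_add (by rwa [hπ.idem, ne_comm])
  rw [hπ.dist_eq_add hxy, dist_comm (π x) y, hyx, dist_comm (π x)]
  ring

theorem dist_le (x y : X) : dist x y ≤ dist x (π x) + dist (π x) (π y) + dist y (π y) :=
  dist_comm y (π y) ▸ dist_triangle4 x (π x) (π y) y

theorem fourPoint (hπ : IsGateProjection π) {x y z w : X}
    (h : FourPoint dist δ (π x) (π y) (π z) (π w)) (hδ : 0 ≤ δ)
    (hxyz : ¬(π x = π y ∧ π x = π z)) (hxyw : ¬(π x = π y ∧ π x = π w))
    (hxzw : ¬(π x = π z ∧ π x = π w)) (hyzw : ¬(π y = π z ∧ π y = π w)) :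
    FourPoint dist δ x y z w := by
  have upper : dist x y + dist z w ≤ dist x (π x) + dist y (π y) + dist z (π z) + dist w (π w) +
      (dist (π x) (π y) + dist (π z) (π w)) := by
    linarith [dist_le (π := π) x y, dist_le (π := π) z w]
  rw [fourPoint_iff] at h ⊢
  by_cases hl : π x ≠ π z ∧ π y ≠ π w <;> by_cases hr : π x ≠ π w ∧ π y ≠ π z
  · rw [hπ.dist_eq hl.1, hπ.dist_eq hl.2, hπ.dist_eq hr.1, hπ.dist_eq hr.2]
    exact h.imp (by intro; linarith) (by intro; linarith)
  · left
    rw [hπ.dist_eq hl.1, hπ.dist_eq hl.2]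
    rcases not_and_or.1 hr with hxw | hyz
    · rw [not_not.1 hxw] at upper ⊢
      linarith [dist_comm (π w) (π y), dist_comm (π w) (π z)]
    · rw [not_not.1 hyz] at upper ⊢
      linarith
  · right
    rw [hπ.dist_eq hr.1, hπ.dist_eq hr.2]
    rcases not_and_or.1 hl with hxz | hyw
    · rw [not_not.1 hxz] at upper ⊢
      linarith [dist_comm (π z) (π y)]
    · rw [not_not.1 hyw] at upper ⊢
      linarith [dist_comm (π z) (π w)]
  · grind

theorem fourPoint_of_eq_eq_ne (hX : ∀ x y : X, x ≠ y → 1 ≤ dist x y) (hπ : IsGateProjection π)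
    {x y z w : X} (hxy : π x = π y) (hxz : π x = π z) (hxw : π x ≠ π w)
    (closer : ∀ q, dist x q + dist y q + dist z q + 1 ≤ dist x w + dist y w + dist z w →
      FourPoint dist δ x y z q) :
    FourPoint dist δ x y z w := by
  have hx := hπ.dist_eq_add hxw
  have hy := hπ.dist_eq_add (hxy ▸ hxw)
  have hz := hπ.dist_eq_add (hxz ▸ hxw)
  rw [← hxy] at hy
  rw [← hxz] at hz
  have hne : π x ≠ w := fun h => hxw (by rw [← h, hπ.idem])
  exact (closer (π x) (by linarith [hX _ _ hne])).of_gate hx hy hz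

end IsGateProjection

/-- If three of the four points have the same projection, then that projection is a gate for the
fourth point, which can be moved there; otherwise the projections decide. -/
theorem isGromovHyperbolic_of_gates (hX : ∀ x y : X, x ≠ y → 1 ≤ dist x y) (hδ : 0 ≤ δ)
    (hgate : ∀ x y : X, x ≠ y → ∃ π : X → X, IsGateProjection π ∧ π x ≠ π y ∧
      ∀ x y z w, FourPoint dist δ (π x) (π y) (π z) (π w)) :
    IsGromovHyperbolic (X := X) dist δ := by
  suffices of_lt : ∀ (n : ℕ) (x y z w : X),
      dist x y + dist x z + dist x w + dist y z + dist y w + dist z w < n →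
        FourPoint dist δ x y z w from
    fun x y z w => (exists_nat_gt _).elim fun n hn => of_lt n x y z w hn
  intro n
  induction n with
  | zero => exact fun x y z w h => absurd h (not_lt.2 (by rw [Nat.cast_zero]; positivity))
  | succ n ih =>
    intro x y z w hn
    rw [Nat.cast_succ] at hn
    by_cases hall : x = y ∧ x = z ∧ x = w
    · obtain ⟨rfl, rfl, rfl⟩ := hall
      simpa [FourPoint] using hδ
    obtain ⟨v, hv, hxv⟩ : ∃ v ∈ ({y, z, w} : Set X), x ≠ v := by
      by_contra! h
      exact hall (by simpa using h)
    obtain ⟨π, hπ, hπv, hF⟩ := hgate x v hxv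
    have hne : ¬(π x = π y ∧ π x = π z ∧ π x = π w) := by
      rintro ⟨hy, hz, hw⟩
      rcases hv with rfl | rfl | rfl <;> contradiction
    by_cases hxyz : π x = π y ∧ π x = π z
    · exact hπ.fourPoint_of_eq_eq_ne hX hxyz.1 hxyz.2 (by tauto)
        fun q hq => ih x y z q (by linarith)
    by_cases hxyw : π x = π y ∧ π x = π w
    · refine (hπ.fourPoint_of_eq_eq_ne hX (w := z) hxyw.1.symm (hxyw.1 ▸ hxyw.2)
        (by grind) fun q hq => ih y x w q ?_).swap_left_right
      linarith [dist_comm x y, dist_comm w z]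
    by_cases hxzw : π x = π z ∧ π x = π w
    · refine (hπ.fourPoint_of_eq_eq_ne hX (w := y) (hxzw.1.symm.trans hxzw.2) hxzw.1.symm
        (by grind) fun q hq => ih z w x q ?_).swap_pairs
      linarith [dist_comm x z, dist_comm x w, dist_comm y z, dist_comm y w]
    by_cases hyzw : π y = π z ∧ π y = π w
    · refine (hπ.fourPoint_of_eq_eq_ne hX (w := x) (hyzw.2.symm.trans hyzw.1) hyzw.2.symm
        (by grind) fun q hq => ih w z y q ?_).swap_pairs.swap_left_right
      linarith [dist_comm x y, dist_comm x z, dist_comm x w, dist_comm y z, dist_comm y w,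
        dist_comm z w]
    exact hπ.fourPoint (hF x y z w) hδ hxyz hxyw hxzw hyzw

end Gate

section GraphGate

variable {V : Type*} {Γ : SimpleGraph V} {π : V → V}

theorem mem_support_and_idem_of_proj_ne (hπ : ∀ u v, Γ.Adj u v → π u ≠ π v → π u = u) {x y : V}
    (p : Γ.Walk x y) (hxy : π x ≠ π y) : π x ∈ p.support ∧ π (π x) = π x := by
  induction p with
  | nil => exact absurd rfl hxy
  | @cons x b _ h p ih =>
    by_cases hxb : π x = π b
    · rw [hxb, SimpleGraph.Walk.support_cons]
      exact (ih (hxb ▸ hxy)).imp_left (List.mem_cons_of_mem x)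
    · simp [hπ x b h hxb]

theorem isGateProjection_of_adj (hΓ : Γ.Connected)
    (hπ : ∀ u v, Γ.Adj u v → π u ≠ π v → π u = u) :
    let := graphMetricSpace hΓ
    IsGateProjection π := by
  intro
  constructor
  · intro x
    by_contra hne
    obtain ⟨p⟩ := hΓ x (π x)
    exact hne (mem_support_and_idem_of_proj_ne hπ p (Ne.symm hne)).2
  · intro x y hxy
    obtain ⟨p, hp⟩ := hΓ.exists_walk_length_eq_dist x y
    have hmem := (mem_support_and_idem_of_proj_ne hπ p hxy).1
    change (Γ.dist x y : ℝ) = Γ.dist x (π x) + Γ.dist (π x) y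
    exact_mod_cast (dist_add_dist_of_mem_support hp hmem).symm

end GraphGate

section FreeProductProjection

open Monoid Monoid.Coprod

open scoped Classical in
/-- The embedding of `G₁ ∗ G₂` into `G₁ ≀ᵣ (G₁ ∗ G₂)` which is the identity on the second component
and whose first component is a cocycle for the left translation action: the translates of the left
factor are recorded separately. -/
noncomputable def coprodToWreath (G₁ G₂ : Type*) [Group G₁] [Group G₂] :
    Coprod G₁ G₂ →* RegularWreathProduct G₁ (Coprod G₁ G₂) :=
  lift
    { toFun a := ⟨fun x => if x ∈ (inl : G₁ →* Coprod G₁ G₂).range then a else 1, inl a⟩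
      map_one' := by ext <;> simp
      map_mul' a b := by
        ext x
        · have hmem : (inl a)⁻¹ * x ∈ (inl : G₁ →* Coprod G₁ G₂).range ↔ x ∈ inl.range :=
            Subgroup.mul_mem_cancel_left _ (inv_mem ⟨a, rfl⟩)
          simp only [RegularWreathProduct.mul_left, Pi.mul_apply, hmem]
          split_ifs <;> simp
        · simp }
    (RegularWreathProduct.inl.comp inr)

variable {G₁ G₂ : Type*} [Group G₁] [Group G₂]

theorem coprodToWreath_right (g : Coprod G₁ G₂) : (coprodToWreath G₁ G₂ g).right = g := by
  suffices h : (RegularWreathProduct.rightHom).comp (coprodToWreath G₁ G₂) = MonoidHom.id _ from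
    DFunLike.congr_fun h g
  exact Coprod.hom_ext rfl rfl

/-- The nearest-point projection of a free product to its left factor. -/
noncomputable def coprodProjLeft (g : Coprod G₁ G₂) : G₁ :=
  (coprodToWreath G₁ G₂ g).left 1

theorem coprodProjLeft_mul (g h : Coprod G₁ G₂) :
    coprodProjLeft (g * h) = coprodProjLeft g * (coprodToWreath G₁ G₂ h).left g⁻¹ := by
  simp [coprodProjLeft, coprodToWreath_right]

theorem coprodProjLeft_mul_inr (g : Coprod G₁ G₂) (b : G₂) :
    coprodProjLeft (g * inr b) = coprodProjLeft g := by
  simp [coprodProjLeft_mul, coprodToWreath]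

theorem coprodProjLeft_mul_inl_of_notMem {g : Coprod G₁ G₂}
    (hg : g ∉ (inl : G₁ →* Coprod G₁ G₂).range) (a : G₁) :
    coprodProjLeft (g * inl a) = coprodProjLeft g := by
  rw [coprodProjLeft_mul, mul_eq_left]
  exact if_neg (inv_mem_iff.not.2 hg)

theorem coprodProjLeft_inl (a : G₁) : coprodProjLeft (inl a : Coprod G₁ G₂) = a :=
  if_pos (one_mem _)

theorem inl_coprodProjLeft_of_mul_inl_ne {g : Coprod G₁ G₂} {a : G₁}
    (h : coprodProjLeft (g * inl a) ≠ coprodProjLeft g) : inl (coprodProjLeft g) = g := by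
  by_contra hg
  refine h (coprodProjLeft_mul_inl_of_notMem ?_ a)
  rintro ⟨k, rfl⟩
  exact hg (by rw [coprodProjLeft_inl])

/-- The nearest-point projection of a free product to its right factor. -/
noncomputable def coprodProjRight (g : Coprod G₁ G₂) : G₂ :=
  coprodProjLeft (swap G₁ G₂ g)

theorem coprodProjRight_inr (b : G₂) : coprodProjRight (inr b : Coprod G₁ G₂) = b := by
  rw [coprodProjRight, swap_inr, coprodProjLeft_inl]

theorem coprodProjRight_mul_inl (g : Coprod G₁ G₂) (a : G₁) :
    coprodProjRight (g * inl a) = coprodProjRight g := by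
  rw [coprodProjRight, map_mul, swap_inl, coprodProjLeft_mul_inr, coprodProjRight]

theorem inr_coprodProjRight_of_mul_inr_ne {g : Coprod G₁ G₂} {b : G₂}
    (h : coprodProjRight (g * inr b) ≠ coprodProjRight g) : inr (coprodProjRight g) = g := by
  rw [coprodProjRight, coprodProjRight, map_mul, swap_inr] at h
  have hswap := congrArg (swap G₂ G₁) (inl_coprodProjLeft_of_mul_inl_ne h)
  rwa [swap_inl, swap_swap] at hswap

theorem mul_inl_eq_one_of_coprodProj_eq_one {g : Coprod G₁ G₂} {a : G₁}
    (hg : coprodProjLeft g = 1 → coprodProjRight g = 1 → g = 1)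
    (hl : coprodProjLeft (g * inl a) = 1) (hr : coprodProjRight (g * inl a) = 1) :
    g * inl a = 1 := by
  by_cases h : coprodProjLeft (g * inl a) = coprodProjLeft g
  · obtain rfl := hg (h ▸ hl) (coprodProjRight_mul_inl g a ▸ hr)
    rw [one_mul, coprodProjLeft_inl] at hl
    rw [hl, map_one, mul_one]
  · rw [← inl_coprodProjLeft_of_mul_inl_ne h, ← map_mul, coprodProjLeft_inl] at hl
    rw [← inl_coprodProjLeft_of_mul_inl_ne h, ← map_mul, hl, map_one]

theorem mul_inr_eq_one_of_coprodProj_eq_one {g : Coprod G₁ G₂} {b : G₂}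
    (hg : coprodProjLeft g = 1 → coprodProjRight g = 1 → g = 1)
    (hl : coprodProjLeft (g * inr b) = 1) (hr : coprodProjRight (g * inr b) = 1) :
    g * inr b = 1 := by
  have hswap : swap G₁ G₂ g * inl b = 1 := by
    refine mul_inl_eq_one_of_coprodProj_eq_one (fun hl' hr' => ?_) ?_ ?_
    · rw [coprodProjRight, swap_swap] at hr'
      rw [hg hr' hl', map_one]
    · rwa [coprodProjRight, map_mul, swap_inr] at hr
    · rwa [coprodProjRight, map_mul, swap_swap, swap_inl]
  simpa using congrArg (swap G₂ G₁) hswap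

theorem eq_one_of_coprodProj_eq_one {g : Coprod G₁ G₂} (hl : coprodProjLeft g = 1)
    (hr : coprodProjRight g = 1) : g = 1 := by
  suffices h : ∀ h : Coprod G₁ G₂, (coprodProjLeft h = 1 → coprodProjRight h = 1 → h = 1) →
      coprodProjLeft (h * g) = 1 → coprodProjRight (h * g) = 1 → h * g = 1 by
    simpa [hl, hr] using h 1 fun _ _ => rfl
  clear hl hr
  induction g using Coprod.induction_on with
  | inl a => exact fun h hh => mul_inl_eq_one_of_coprodProj_eq_one hh
  | inr b => exact fun h hh => mul_inr_eq_one_of_coprodProj_eq_one hh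
  | mul x y hx hy => exact fun h hh => mul_assoc h x y ▸ hy (h * x) (hx h hh)

end FreeProductProjection

section FreeProductHyperbolic

open Monoid Monoid.Coprod

variable {G K : Type*} [Group G] [Group K]

theorem IsFiniteSymmGenSet.isGateProjection_coset {B : Set G} (hB : IsFiniteSymmGenSet B)
    {φ : K →* G} {r : G → K} (hr : ∀ g, ∀ b ∈ B, r (g * b) ≠ r g → φ (r g) = g) (x : G) :
    let := hB.metricSpace
    IsGateProjection fun z => x * φ (r (x⁻¹ * z)) := by
  refine isGateProjection_of_adj hB.connected fun u v huv hne => ?_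
  obtain ⟨b, hb, rfl⟩ := hB.exists_eq_mul_of_adj huv
  rw [hr (x⁻¹ * u) b hb fun h => hne (by rw [← mul_assoc, h]), mul_inv_cancel_left]

theorem IsFiniteSymmGenSet.exists_gate {A : Set K} {B : Set G} (hB : IsFiniteSymmGenSet B)
    {φ : K →* G} {r : G → K} {δ : ℝ} (hA : IsGromovHyperbolic (wordDist A) δ)
    (hφ : ∀ u v, wordDist B (φ u) (φ v) = wordDist A u v)
    (hr : ∀ g, ∀ b ∈ B, r (g * b) ≠ r g → φ (r g) = g) (hrφ : Function.LeftInverse r φ)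
    {x y : G} (hxy : r (x⁻¹ * y) ≠ 1) :
    let := hB.metricSpace
    ∃ π : G → G, IsGateProjection π ∧ π x ≠ π y ∧
      ∀ x y z w, FourPoint dist δ (π x) (π y) (π z) (π w) := by
  intro
  refine ⟨_, hB.isGateProjection_coset hr x, ?_, ?_⟩
  · have hr1 : r 1 = 1 := by rw [← map_one φ, hrφ]
    simp only [inv_mul_cancel, hr1, map_one, mul_one, ne_eq, left_eq_mul]
    exact fun h => hxy (by rw [← hrφ (r _), h, hr1])
  · intro a b c d
    change FourPoint (wordDist B) _ _ _ _ _
    simp only [FourPoint, hB.wordDist_mul_left, hφ]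
    exact hA _ _ _ _

variable {G₁ G₂ : Type*} [Group G₁] [Group G₂] {A₁ : Set G₁} {A₂ : Set G₂}

/-- The generating set of the free product formed by generating sets of the factors. -/
def coprodGenSet (A₁ : Set G₁) (A₂ : Set G₂) : Set (Coprod G₁ G₂) :=
  inl '' A₁ ∪ inr '' A₂

namespace IsFiniteSymmGenSet

theorem coprod (h₁ : IsFiniteSymmGenSet A₁) (h₂ : IsFiniteSymmGenSet A₂) :
    IsFiniteSymmGenSet (coprodGenSet A₁ A₂) where
  finite := (h₁.finite.image _).union (h₂.finite.image _)
  symm := by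
    rw [coprodGenSet, Set.union_inv, ← Set.image_inv, ← Set.image_inv, h₁.symm, h₂.symm]
  closure_eq_top := by
    rw [coprodGenSet, Subgroup.closure_union, ← MonoidHom.map_closure, ← MonoidHom.map_closure,
      h₁.closure_eq_top, h₂.closure_eq_top, ← MonoidHom.range_eq_map, ← MonoidHom.range_eq_map,
      range_inl_sup_range_inr]

theorem wordDist_inl (h₁ : IsFiniteSymmGenSet A₁) (h₂ : IsFiniteSymmGenSet A₂) (u v : G₁) :
    wordDist (coprodGenSet A₁ A₂) (inl u) (inl v) = wordDist A₁ u v := by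
  refine h₁.wordDist_map_eq_of_leftInverse (h₁.coprod h₂) (ψ := fst)
    (fun a ha => .inr (.inl ⟨a, ha, rfl⟩)) ?_ fst_apply_inl u v
  rintro _ (⟨a, ha, rfl⟩ | ⟨b, -, rfl⟩) <;> simp [*]

theorem wordDist_inr (h₁ : IsFiniteSymmGenSet A₁) (h₂ : IsFiniteSymmGenSet A₂) (u v : G₂) :
    wordDist (coprodGenSet A₁ A₂) (inr u) (inr v) = wordDist A₂ u v := by
  refine h₂.wordDist_map_eq_of_leftInverse (h₁.coprod h₂) (ψ := snd)
    (fun b hb => .inr (.inr ⟨b, hb, rfl⟩)) ?_ snd_apply_inr u v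
  rintro _ (⟨a, -, rfl⟩ | ⟨b, hb, rfl⟩) <;> simp [*]

theorem isGromovHyperbolic_coprodGenSet (h₁ : IsFiniteSymmGenSet A₁)
    (h₂ : IsFiniteSymmGenSet A₂) {δ : ℝ} (hδ₁ : IsGromovHyperbolic (wordDist A₁) δ)
    (hδ₂ : IsGromovHyperbolic (wordDist A₂) δ) :
    IsGromovHyperbolic (wordDist (coprodGenSet A₁ A₂)) δ := by
  have hδ : 0 ≤ δ := let := h₁.metricSpace; IsGromovHyperbolic.nonneg hδ₁
  have hB := h₁.coprod h₂
  let := hB.metricSpace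
  refine isGromovHyperbolic_of_gates (fun x y hxy => ?_) hδ fun x y hxy => ?_
  · exact Nat.one_le_cast.2 (hB.connected.pos_dist_of_ne hxy)
  by_cases hl : coprodProjLeft (x⁻¹ * y) = 1
  · refine hB.exists_gate hδ₂ (h₁.wordDist_inr h₂) ?_ coprodProjRight_inr
      fun hr => hxy (inv_mul_eq_one.1 (eq_one_of_coprodProj_eq_one hl hr))
    rintro g _ (⟨a, -, rfl⟩ | ⟨b, -, rfl⟩) hne
    · exact absurd (coprodProjRight_mul_inl g a) hne
    · exact inr_coprodProjRight_of_mul_inr_ne hne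
  · refine hB.exists_gate hδ₁ (h₁.wordDist_inl h₂) ?_ coprodProjLeft_inl hl
    rintro g _ (⟨a, -, rfl⟩ | ⟨b, -, rfl⟩) hne
    · exact inl_coprodProjLeft_of_mul_inl_ne hne
    · exact absurd (coprodProjLeft_mul_inr g b) hne

end IsFiniteSymmGenSet

end FreeProductHyperbolic

section Morse

variable {X : Type*} [PseudoMetricSpace X] {δ D R : ℝ}

theorem FourPoint.dist_add_le_trans {x y z o : X} {M : ℝ} (h : FourPoint dist δ x z y o)
    (hxy : dist x y + 2 * M ≤ dist x o + dist y o)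
    (hyz : dist y z + 2 * M ≤ dist y o + dist z o) :
    dist x z + 2 * (M - δ) ≤ dist x o + dist z o := by
  rw [fourPoint_iff, dist_comm z y] at h
  rcases h with h | h <;> linarith

namespace IsGromovHyperbolic

/-- The number of points of the chain may double each time the constant decreases by `δ`. -/
theorem dist_add_le_of_chain (hX : IsGromovHyperbolic (X := X) dist δ) (hR : 0 ≤ R) {o : X}
    (k : ℕ) {x : ℕ → X} {N : ℕ} (hN : N ≤ 2 ^ k) (hx : ∀ i < N, dist (x i) (x (i + 1)) ≤ R)
    (ho : ∀ i ≤ N, D ≤ dist (x i) o) :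
    dist (x 0) (x N) + 2 * (D - R - k * δ) ≤ dist (x 0) o + dist (x N) o := by
  induction k generalizing x N with
  | zero =>
    rw [pow_zero] at hN
    interval_cases N
    · have := ho 0 le_rfl
      simp only [dist_self, Nat.cast_zero]
      linarith
    · have := ho 0 zero_le_one
      have := ho 1 le_rfl
      have := hx 0 one_pos
      simp only [zero_add, Nat.cast_zero] at *
      linarith
  | succ k ih =>
    rw [pow_succ] at hN
    have hleft := ih (x := x) (N := N / 2) (by omega) (fun i hi => hx i (by omega))
      fun i hi => ho i (by omega)
    have hright := ih (x := fun i => x (N / 2 + i)) (N := N - N / 2) (by omega)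
      (fun i hi => hx (N / 2 + i) (by omega)) fun i hi => ho (N / 2 + i) (by omega)
    simp only [add_zero, Nat.add_sub_cancel' (Nat.div_le_self N 2)] at hright
    have := (hX (x 0) (x N) (x (N / 2)) o).dist_add_le_trans hleft hright
    rw [Nat.cast_succ]
    linarith

end IsGromovHyperbolic

/-- A discrete quasigeodesic with steps of length at most `R` on which distances are bounded below
by `C⁻¹` times the difference of the parameters; only the values `c 0, …, c m` matter. -/
structure IsQuasigeodesicSeq (C R : ℝ) (c : ℕ → X) (m : ℕ) : Prop where
  dist_succ_le : ∀ i < m, dist (c i) (c (i + 1)) ≤ R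
  sub_le : ∀ i j, i ≤ j → j ≤ m → (j : ℝ) - i ≤ C * dist (c i) (c j)

theorem IsQuasigeodesicSeq.dist_add_le {C : ℝ} {c : ℕ → X} {m : ℕ}
    (hc : IsQuasigeodesicSeq C R c m) (hX : IsGromovHyperbolic (X := X) dist δ) (hR : 0 ≤ R)
    {o : X} (ho : ∀ i ≤ m, D ≤ dist (c i) o) {i j k : ℕ} (hi : i ≤ m) (hj : j ≤ m)
    (hk : C * dist (c i) (c j) ≤ 2 ^ k) :
    dist (c i) (c j) + 2 * (D - R - k * δ) ≤ dist (c i) o + dist (c j) o := by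
  wlog hij : i ≤ j generalizing i j
  · rw [dist_comm, add_comm (dist (c i) o)]
    exact this hj hi (by rwa [dist_comm]) (by omega)
  have hN : j - i ≤ 2 ^ k := by
    have := (hc.sub_le i j hij hj).trans hk
    rw [← Nat.cast_sub hij] at this
    exact_mod_cast this
  simpa only [add_zero, Nat.add_sub_cancel' hij] using
    hX.dist_add_le_of_chain hR k (x := fun l => c (i + l)) hN
      (fun l hl => hc.dist_succ_le (i + l) (by omega)) fun l hl => ho (i + l) (by omega)

theorem IsGeodesicSeq.exists_dist_add_le {q : ℕ → X} {s : ℕ} {S : Set X}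
    (hq : IsGeodesicSeq q s) (hR : 0 ≤ R) (hS : ∀ y ∈ S, D ≤ dist y (q 0))
    (hD : ∀ i ≤ s, ∃ y ∈ S, dist (q i) y ≤ D) (hs : ∃ y ∈ S, dist (q s) y ≤ R) :
    ∃ a ≤ s, ∃ y ∈ S, a ≤ 2 * D + 1 ∧ dist (q a) y ≤ D + R ∧
      dist (q a) y + 2 * (D - R) ≤ dist (q a) (q 0) + dist y (q 0) := by
  have hD₀ : 0 ≤ D := (hD 0 s.zero_le).elim fun y hy => dist_nonneg.trans hy.2
  by_cases h : ⌈2 * D⌉₊ ≤ s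
  · obtain ⟨y, hy, hay⟩ := hD _ h
    refine ⟨_, h, y, hy, (Nat.ceil_lt_add_one (by positivity)).le, by linarith, ?_⟩
    have := hS y hy
    have := Nat.le_ceil (2 * D)
    rw [dist_comm _ (q 0), hq 0 _ (Nat.zero_le _) h, Nat.cast_zero]
    linarith
  · obtain ⟨y, hy, hsy⟩ := hs
    refine ⟨s, le_rfl, y, hy, ?_, by linarith, ?_⟩
    · have := Nat.lt_ceil.1 (not_le.1 h)
      linarith
    · have := hS y hy
      have := dist_triangle_left y (q 0) (q s)
      linarith

theorem IsGeodesicSeq.shift {p : ℕ → X} {n t : ℕ} (hp : IsGeodesicSeq p n) (ht : t ≤ n) :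
    IsGeodesicSeq (fun i => p (t + i)) (n - t) := by
  intro i j hij hj
  rw [hp (t + i) (t + j) (by omega) (by omega)]
  push_cast
  ring

theorem IsGeodesicSeq.reverse {p : ℕ → X} {n t : ℕ} (hp : IsGeodesicSeq p n) (ht : t ≤ n) :
    IsGeodesicSeq (fun i => p (t - i)) t := by
  intro i j hij hj
  rw [dist_comm, hp (t - j) (t - i) (by omega) (by omega), Nat.cast_sub hj,
    Nat.cast_sub (hij.trans hj)]
  ring

/-- As `k` can be taken of the order of `log D`, this bounds `D` by its own logarithm. -/
theorem IsQuasigeodesicSeq.le_of_isMax_dist {C : ℝ} {p c : ℕ → X} {n m t k : ℕ}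
    (hX : IsGromovHyperbolic (X := X) dist δ) (hp : IsGeodesicSeq p n)
    (hc : IsQuasigeodesicSeq C R c m) (hC : 0 ≤ C) (h0 : dist (p 0) (c 0) ≤ R)
    (hn : dist (p n) (c m) ≤ R) (ht : t ≤ n) (hDt : ∀ j ≤ m, D ≤ dist (c j) (p t))
    (hD : ∀ s ≤ n, ∃ j ≤ m, dist (p s) (c j) ≤ D) (hk : C * (6 * D + 2 * R + 2) ≤ 2 ^ k) :
    D ≤ R + (k + 2) * δ := by
  have hR : 0 ≤ R := dist_nonneg.trans h0
  have hX₀ : 0 ≤ δ := have : Nonempty X := ⟨p 0⟩; hX.nonneg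
  obtain ⟨a, ha, _, ⟨i, hi, rfl⟩, ha', hai, hgi⟩ :=
    (hp.reverse ht).exists_dist_add_le (S := c '' Set.Iic m) hR (by simpa using hDt)
      (fun s hs => by simpa using hD (t - s) (by omega)) (by simpa using ⟨0, m.zero_le, h0⟩)
  obtain ⟨b, hb, _, ⟨j, hj, rfl⟩, hb', hbj, hgj⟩ :=
    (hp.shift ht).exists_dist_add_le (S := c '' Set.Iic m) hR (by simpa using hDt)
      (fun s hs => by simpa using hD (t + s) (by omega))
      (by simpa [Nat.add_sub_cancel' ht] using ⟨m, le_rfl, hn⟩)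
  simp only [Nat.sub_zero, add_zero] at hgi hgj
  have hta : dist (p (t - a)) (p t) = a := by
    rw [hp _ _ (by omega) ht, Nat.cast_sub ha, sub_sub_cancel]
  have htb : dist (p (t + b)) (p t) = b := by
    rw [dist_comm, hp _ _ (by omega) (by omega), Nat.cast_add, add_sub_cancel_left]
  have hab : dist (p (t - a)) (p (t + b)) = a + b := by
    rw [hp _ _ (by omega) (by omega), Nat.cast_sub ha, Nat.cast_add]
    ring
  have hij : dist (c i) (c j) ≤ 6 * D + 2 * R + 2 := by
    have := dist_triangle4 (c i) (p (t - a)) (p (t + b)) (c j)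
    rw [dist_comm (c i) (p _), hab] at this
    linarith
  have hgij := hc.dist_add_le hX hR hDt hi hj ((mul_le_mul_of_nonneg_left hij hC).trans hk)
  have hkδ : 0 ≤ k * δ := by positivity
  have haj := (hX (p (t - a)) (c j) (c i) (p t)).dist_add_le_trans (by linarith) hgij
  have := (hX (p (t - a)) (p (t + b)) (c j) (p t)).dist_add_le_trans haj
    (by rw [dist_comm]; linarith)
  linarith

open Filter Asymptotics in
theorem eventually_exists_le_two_pow (a b R : ℝ) (hδ : 0 ≤ δ) :
    ∀ᶠ D : ℝ in atTop, ∃ k : ℕ, a * D + b ≤ 2 ^ k ∧ R + (k + 2) * δ < D := by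
  have linear_le (a b : ℝ) : ∀ᶠ k : ℕ in atTop, a * k + b ≤ 2 ^ k := by
    have tendsto_pow : Tendsto (fun k : ℕ => ‖(2 : ℝ) ^ k‖) atTop atTop :=
      tendsto_norm_atTop_atTop.comp (tendsto_pow_atTop_atTop_of_one_lt one_lt_two)
    have hconst : (fun _ : ℕ => b) =o[atTop] fun k => (2 : ℝ) ^ k :=
      isLittleO_const_left.2 (.inr tendsto_pow)
    have hlinear := (isLittleO_coe_const_pow_of_one_lt one_lt_two).const_mul_left a
    filter_upwards [(hlinear.add hconst).bound one_pos] with k hk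
    rw [one_mul, Real.norm_of_nonneg (by positivity : (0 : ℝ) ≤ 2 ^ k)] at hk
    exact (Real.le_norm_self _).trans hk
  have tendsto_floor : Tendsto (fun D : ℝ => ⌊D / (2 * (δ + 1))⌋₊) atTop atTop :=
    tendsto_nat_floor_atTop.comp (tendsto_id.atTop_div_const (by positivity))
  have linear_le_floor := tendsto_floor.eventually
    (linear_le (|a| * (2 * (δ + 1))) (|a| * (2 * (δ + 1)) + b))
  filter_upwards [linear_le_floor, eventually_gt_atTop (2 * (R + 2 * δ)),
    eventually_ge_atTop 0] with D hD hDR hD₀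
  refine ⟨_, hD.trans' ?_, ?_⟩
  · have hfloor := Nat.lt_floor_add_one (D / (2 * (δ + 1)))
    rw [div_lt_iff₀ (by positivity)] at hfloor
    have := mul_le_mul_of_nonneg_left hfloor.le (abs_nonneg a)
    have := mul_le_mul_of_nonneg_right (le_abs_self a) hD₀
    linarith
  · have hfloor := Nat.floor_le (show 0 ≤ D / (2 * (δ + 1)) by positivity)
    rw [le_div_iff₀ (by positivity)] at hfloor
    have : 0 ≤ (⌊D / (2 * (δ + 1))⌋₊ : ℝ) := by positivity
    linarith

theorem IsGromovHyperbolic.exists_dist_le_of_isQuasigeodesicSeq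
    (hX : IsGromovHyperbolic (X := X) dist δ) {C : ℝ} (hC : 0 ≤ C) (R : ℝ) :
    ∃ D, ∀ (p c : ℕ → X) (n m : ℕ), IsGeodesicSeq p n → IsQuasigeodesicSeq C R c m →
      dist (p 0) (c 0) ≤ R → dist (p n) (c m) ≤ R → ∀ s ≤ n, ∃ j ≤ m, dist (p s) (c j) ≤ D := by
  cases isEmpty_or_nonempty X
  · exact ⟨0, fun p => isEmptyElim (p 0)⟩
  obtain ⟨D, hD⟩ := Filter.eventually_atTop.1
    (eventually_exists_le_two_pow (C * 6) (C * (2 * R + 2)) R hX.nonneg)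
  refine ⟨D, fun p c n m hp hc h0 hn => ?_⟩
  have exists_nearest (s : ℕ) : ∃ j ≤ m, ∀ i ≤ m, dist (p s) (c j) ≤ dist (p s) (c i) :=
    Set.exists_min_image (Set.Iic m) (fun j => dist (p s) (c j)) (Set.finite_Iic m) ⟨0, m.zero_le⟩
  choose j hj hjmin using exists_nearest
  obtain ⟨t, ht, htmax⟩ := Set.exists_max_image (Set.Iic n) (fun s => dist (p s) (c (j s)))
    (Set.finite_Iic n) ⟨0, n.zero_le⟩
  refine fun s hs => ⟨j s, hj s, (htmax s hs).trans ?_⟩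
  by_contra! hDt
  obtain ⟨k, hk, hkD⟩ := hD _ hDt.le
  refine hkD.not_ge (hc.le_of_isMax_dist hX hp hC h0 hn ht (fun i hi => ?_)
    (fun s hs => ⟨j s, hj s, htmax s hs⟩) ?_)
  · rw [dist_comm (c i)]
    exact hjmin t i hi
  · linarith

end Morse

section QuasiconvexSubgroups

variable {G : Type*} [Group G] {A B : Set G}

namespace IsFiniteSymmGenSet

theorem exists_isGeodesicSeq (hA : IsFiniteSymmGenSet A) {u v x : G}
    (hx : wordDist A u x + wordDist A x v = wordDist A u v) :
    let := hA.metricSpace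
    ∃ (p : ℕ → G) (n : ℕ), IsGeodesicSeq p n ∧ p 0 = u ∧ p n = v ∧ ∃ s ≤ n, p s = x := by
  unfold wordDist at hx
  exact _root_.exists_isGeodesicSeq hA.connected (mod_cast hx)

theorem isQuasigeodesicSeq (hA : IsFiniteSymmGenSet A) (hB : IsFiniteSymmGenSet B) {L C : ℝ}
    (hL : ∀ u v, wordDist B u v ≤ L * wordDist A u v)
    (hC : ∀ u v, wordDist A u v ≤ C * wordDist B u v) {c : ℕ → G} {m : ℕ}
    (hc : let := hA.metricSpace; IsGeodesicSeq c m) :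
    let := hB.metricSpace
    IsQuasigeodesicSeq C L c m := by
  refine @IsQuasigeodesicSeq.mk _ (_) _ _ _ _ (fun i hi => ?_) fun i j hij hj => ?_
  · have hstep : wordDist A (c i) (c (i + 1)) = 1 :=
      (hc i (i + 1) i.le_succ hi).trans (by simp)
    exact (hL _ _).trans_eq (by rw [hstep, mul_one])
  · exact (hc i j hij hj).symm.trans_le (hC _ _)

theorem exists_forall_between_near (hA : IsFiniteSymmGenSet A) (hB : IsFiniteSymmGenSet B) {δ : ℝ}
    (hδ : IsGromovHyperbolic (wordDist B) δ) (r : ℝ) :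
    ∃ D, ∀ u v u' v' x, wordDist B u u' ≤ r → wordDist B v v' ≤ r →
      wordDist B u x + wordDist B x v = wordDist B u v →
      ∃ y, wordDist A u' y + wordDist A y v' = wordDist A u' v' ∧ wordDist B x y ≤ D := by
  obtain ⟨L, -, hL⟩ := hA.exists_wordDist_map_le hB (MonoidHom.id G)
  obtain ⟨C, hC₀, hC⟩ := hB.exists_wordDist_map_le hA (MonoidHom.id G)
  let := hB.metricSpace
  obtain ⟨D, hD⟩ := IsGromovHyperbolic.exists_dist_le_of_isQuasigeodesicSeq hδ hC₀ (max L r)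
  refine ⟨D, fun u v u' v' x hu hv hx => ?_⟩
  obtain ⟨p, n, hp, rfl, rfl, s, hs, rfl⟩ := hB.exists_isGeodesicSeq hx
  obtain ⟨c, m, hc, rfl, rfl, -⟩ := hA.exists_isGeodesicSeq (u := u') (v := v') (x := u')
    (by simp [wordDist])
  have hL' (u v : G) : wordDist B u v ≤ max L r * wordDist A u v :=
    (hL u v).trans (mul_le_mul_of_nonneg_right (le_max_left L r) (Nat.cast_nonneg _))
  have hc' := hA.isQuasigeodesicSeq hB hL' hC hc
  obtain ⟨j, hj, hsj⟩ := hD p c n m hp hc' (hu.trans (le_max_right _ _))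
    (hv.trans (le_max_right _ _)) s hs
  let := hA.metricSpace
  exact ⟨c j, hc.dist_add_dist hj, hsj⟩

end IsFiniteSymmGenSet

theorem IsQuasiconvexWith.of_hausdorff {Q Q' : Set G} (hQ : IsQuasiconvexWith A Q)
    (hA : IsFiniteSymmGenSet A) (hB : IsFiniteSymmGenSet B) {δ : ℝ}
    (hδ : IsGromovHyperbolic (wordDist B) δ) {r : ℝ} (hr : ∀ u ∈ Q', ∃ q ∈ Q, wordDist B u q ≤ r)
    (hr' : ∀ q ∈ Q, ∃ u ∈ Q', wordDist B q u ≤ r) : IsQuasiconvexWith B Q' := by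
  obtain ⟨η, -, hQ⟩ := hA.isQuasiconvexWith_iff.1 hQ
  obtain ⟨D, hD⟩ := hA.exists_forall_between_near hB hδ r
  obtain ⟨L, hL₀, hL⟩ := hA.exists_wordDist_map_le hB (MonoidHom.id G)
  refine hB.isQuasiconvexWith_iff.2 ⟨max 0 (D + L * η + r), le_max_left _ _,
    fun u hu v hv x hx => ?_⟩
  obtain ⟨u', hu', huu'⟩ := hr u hu
  obtain ⟨v', hv', hvv'⟩ := hr v hv
  obtain ⟨y, hy, hxy⟩ := hD u v u' v' x huu' hvv' hx
  obtain ⟨q, hq, hyq⟩ := hQ u' hu' v' hv' y hy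
  obtain ⟨w, hw, hqw⟩ := hr' q hq
  have hyq' := (hL y q).trans (mul_le_mul_of_nonneg_left hyq hL₀)
  let := hB.metricSpace
  have := dist_triangle4 x y q w
  exact ⟨w, hw, (this.trans (add_le_add_three hxy hyq' hqw)).trans (le_max_right _ _)⟩

theorem IsQuasiconvexWith.smul {Q : Set G} (hQ : IsQuasiconvexWith A Q)
    (hA : IsFiniteSymmGenSet A) (g : G) : IsQuasiconvexWith A (g • Q) := by
  obtain ⟨η, hη, hQ⟩ := hA.isQuasiconvexWith_iff.1 hQ
  refine hA.isQuasiconvexWith_iff.2 ⟨η, hη, ?_⟩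
  rintro _ ⟨u, hu, rfl⟩ _ ⟨v, hv, rfl⟩ x hx
  obtain ⟨y, rfl⟩ : ∃ y, g * y = x := ⟨g⁻¹ * x, mul_inv_cancel_left g x⟩
  simp only [smul_eq_mul, hA.wordDist_mul_left] at hx
  obtain ⟨q, hq, hyq⟩ := hQ u hu v hv y hx
  exact ⟨g * q, Set.smul_mem_smul_set hq, (hA.wordDist_mul_left g y q).trans_le hyq⟩

theorem IsQuasiconvexWith.conj {H : Subgroup G} (hH : IsQuasiconvexWith A (H : Set G))
    (hA : IsFiniteSymmGenSet A) (hB : IsFiniteSymmGenSet B) {δ : ℝ}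
    (hδ : IsGromovHyperbolic (wordDist B) δ) (g : G) :
    IsQuasiconvexWith B ((MulAut.conj g • H : Subgroup G) : Set G) := by
  have wordDist_mul_inv (h : G) : wordDist B (g * h * g⁻¹) (g * h) = wordDist B 1 g := by
    rw [hB.wordDist_eq_wordDist_one]
    group
  refine (hH.smul hA g).of_hausdorff hA hB hδ (r := wordDist B 1 g) ?_ ?_
  · rintro _ ⟨h, hh, rfl⟩
    exact ⟨g * h, Set.smul_mem_smul_set hh, (wordDist_mul_inv h).le⟩
  · rintro _ ⟨h, hh, rfl⟩
    refine ⟨g * h * g⁻¹, ⟨h, hh, rfl⟩, ?_⟩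
    let := hB.metricSpace
    exact (dist_comm (g * h) _).trans_le (wordDist_mul_inv h).le

theorem IsQuasiconvexWith.comap {P : Type*} [Group P] {A : Set P} {H : Subgroup G}
    (hH : IsQuasiconvexWith B (H : Set G)) (hA : IsFiniteSymmGenSet A)
    (hB : IsFiniteSymmGenSet B) {φ : P →* G}
    (hφ : ∀ u v, wordDist B (φ u) (φ v) = wordDist A u v) :
    IsQuasiconvexWith A (H.comap φ : Set P) := by
  obtain ⟨η, -, hH⟩ := hB.isQuasiconvexWith_iff.1 hH
  have exists_bound (g : G) : ∃ x : P, (∃ y, φ y * g ∈ H) → φ x * g ∈ H := by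
    by_cases h : ∃ y, φ y * g ∈ H
    exacts [h.imp fun y hy _ => hy, ⟨1, fun h' => absurd h' h⟩]
  choose f hf using exists_bound
  obtain ⟨η', hη'⟩ := ((hB.finite_closedBall η).image fun g => wordDist A (f g) 1).bddAbove
  refine hA.isQuasiconvexWith_iff.2 ⟨max 0 η', le_max_left _ _, fun u hu v hv x hx => ?_⟩
  obtain ⟨h, hh, hxh⟩ := hH _ hu _ hv (φ x) (by simpa only [hφ] using hx)
  rw [hB.wordDist_eq_wordDist_one] at hxh
  have hfh : φ (f ((φ x)⁻¹ * h)) * ((φ x)⁻¹ * h) ∈ H := hf _ ⟨x, by simpa using hh⟩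
  refine ⟨x * (f ((φ x)⁻¹ * h))⁻¹, ?_, ?_⟩
  · have := H.mul_mem hh (H.inv_mem hfh)
    simpa [mul_assoc] using this
  · rw [hA.wordDist_eq_wordDist_one, inv_mul_cancel_left, ← hA.wordDist_mul_left (f _), mul_one,
      mul_inv_cancel]
    exact (hη' ⟨_, hxh, rfl⟩).trans (le_max_right _ _)

theorem IsQuasiconvexWith.fg {H : Subgroup G} (hH : IsQuasiconvexWith A (H : Set G))
    (hA : IsFiniteSymmGenSet A) : H.FG := by
  obtain ⟨η, hη, hH⟩ := hA.isQuasiconvexWith_iff.1 hH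
  let F : Set G := {x | wordDist A 1 x ≤ η + 1 + η} ∩ H
  refine (Subgroup.fg_iff _).2 ⟨F, le_antisymm ((Subgroup.closure_le _).2 Set.inter_subset_right)
    fun h hh => ?_, (hA.finite_closedBall _).subset Set.inter_subset_left⟩
  let := hA.metricSpace
  obtain ⟨p, n, hp, hp0, hpn, -⟩ := hA.exists_isGeodesicSeq (u := 1) (v := h) (x := 1)
    (by simp [wordDist])
  have exists_near {i : ℕ} (hi : i ≤ n) : ∃ q ∈ H, wordDist A (p i) q ≤ η :=
    hH 1 (one_mem H) h hh (p i) (hp0 ▸ hpn ▸ hp.dist_add_dist hi)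
  suffices key : ∀ i ≤ n, ∀ q ∈ H, wordDist A (p i) q ≤ η → q ∈ Subgroup.closure F from
    key n le_rfl h hh (by simpa [hpn, wordDist] using hη)
  intro i hi
  induction i with
  | zero =>
    intro q hq hpq
    rw [hp0] at hpq
    exact Subgroup.subset_closure ⟨hpq.trans (by linarith), hq⟩
  | succ i ih =>
    intro q hq hpq
    obtain ⟨q', hq', hpq'⟩ := exists_near (Nat.le_of_succ_le hi)
    have hstep : dist (p i) (p (i + 1)) = 1 := by simpa using hp i (i + 1) i.le_succ hi
    have hqq' : q'⁻¹ * q ∈ F := by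
      refine ⟨?_, H.mul_mem (H.inv_mem hq') hq⟩
      have := dist_triangle4 q' (p i) (p (i + 1)) q
      rw [hstep, dist_comm q' (p i)] at this
      rw [Set.mem_ofPred, ← hA.wordDist_eq_wordDist_one]
      exact this.trans (add_le_add_three hpq' le_rfl hpq)
    have := (Subgroup.closure F).mul_mem (ih (Nat.le_of_succ_le hi) q' hq' hpq')
      (Subgroup.subset_closure hqq')
    rwa [mul_inv_cancel_left] at this

end QuasiconvexSubgroups

section Profinite

variable {G : Type*} [Group G]

theorem exists_normal_mul_mem_of_isOpen {U : Set G} (hU : IsOpen[profiniteTopology G] U) {a : G}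
    (ha : a ∈ U) : ∃ N : Subgroup G, N.Normal ∧ N.FiniteIndex ∧ ∀ n ∈ N, a * n ∈ U := by
  induction hU with
  | basic V hV =>
    obtain ⟨N, hN, hN', g, rfl⟩ := hV
    obtain ⟨b, hb, rfl⟩ := ha
    exact ⟨N, hN, hN', fun n hn => ⟨b * n, N.mul_mem hb hn, (mul_assoc g b n).symm⟩⟩
  | univ => exact ⟨⊤, inferInstance, inferInstance, fun _ _ => trivial⟩
  | inter V W _ _ hV hW =>
    obtain ⟨N, hN, hN', h⟩ := hV ha.1
    obtain ⟨M, hM, hM', h'⟩ := hW ha.2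
    exact ⟨N ⊓ M, inferInstance, inferInstance, fun n hn => ⟨h n hn.1, h' n hn.2⟩⟩
  | sUnion 𝒱 _ h𝒱 =>
    obtain ⟨V, hV, haV⟩ := ha
    obtain ⟨N, hN, hN', h⟩ := h𝒱 V hV haV
    exact ⟨N, hN, hN', fun n hn => ⟨V, hV, h n hn⟩⟩

theorem isClosed_profiniteTopology_of_forall_notMem {H : Subgroup G}
    (h : ∀ g ∉ H, ∃ M : Subgroup G, M.FiniteIndex ∧ H ≤ M ∧ g ∉ M) :
    IsClosed[profiniteTopology G] (H : Set G) := by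
  let := profiniteTopology G
  refine ⟨isOpen_iff_forall_mem_open.2 fun g hg => ?_⟩
  obtain ⟨M, hM, hHM, hgM⟩ := h g hg
  refine ⟨g • (M.normalCore : Set G), ?_, TopologicalSpace.isOpen_generateFrom_of_mem
    ⟨M.normalCore, inferInstance, inferInstance, g, rfl⟩, ⟨1, one_mem _, mul_one g⟩⟩
  rintro _ ⟨n, hn, rfl⟩ hgn
  exact hgM ((M.mul_mem_cancel_right (M.normalCore_le hn)).1 (hHM hgn))

end Profinite

section PermutationActions

open MulAction

variable {G Ω : Type*} [Group G]

/-- The stabilizer of a point under an action given as a homomorphism to permutations. -/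
def pointStabilizer (τ : G →* Equiv.Perm Ω) (ω : Ω) : Subgroup G :=
  (stabilizer (Equiv.Perm Ω) ω).comap τ

theorem mem_pointStabilizer {τ : G →* Equiv.Perm Ω} {ω : Ω} {g : G} :
    g ∈ pointStabilizer τ ω ↔ τ g ω = ω :=
  Iff.rfl

/-- The set of points moved by an action given as a homomorphism to permutations. -/
def jointSupport (ρ : G →* Equiv.Perm Ω) : Set Ω :=
  {ω | ∃ g, ρ g ω ≠ ω}

/-- The action `ρ` agrees with `τ` on the part of the action `τ` which can be seen inside `S`. -/
def AgreeOn (τ ρ : G →* Equiv.Perm Ω) (S : Set Ω) : Prop :=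
  ∀ a, ∀ s ∈ S, τ a s ∈ S → ρ a s = τ a s

theorem AgreeOn.mono {τ ρ : G →* Equiv.Perm Ω} {S T : Set Ω} (h : AgreeOn τ ρ T) (hST : S ⊆ T) :
    AgreeOn τ ρ S :=
  fun a s hs has => h a s (hST hs) (hST has)

theorem finiteIndex_pointStabilizer {ρ : G →* Equiv.Perm Ω} (hρ : (jointSupport ρ).Finite)
    (ω : Ω) : (pointStabilizer ρ ω).FiniteIndex := by
  let := compHom Ω ρ
  have horbit : orbit G ω ⊆ insert ω (jointSupport ρ) := by
    rintro _ ⟨g, rfl⟩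
    refine or_iff_not_imp_left.2 fun hg => ⟨g⁻¹, ?_⟩
    change g⁻¹ • g • ω ≠ g • ω
    rwa [inv_smul_smul, ne_comm]
  have := ((hρ.insert ω).subset horbit).to_subtype
  have := Finite.of_equiv _ (orbitEquivQuotientStabilizer G ω)
  exact Subgroup.finiteIndex_of_finite_quotient (H := stabilizer G ω)

/-- The finite orbits are lifted to `Ω` along a section of `q` through `S`, and the rest of `Ω` is
fixed. -/
theorem exists_finite_jointSupport_of_injOn [MulAction G Ω] {Θ : Type*} [MulAction G Θ]
    {q : Ω → Θ} (hq : ∀ (g : G) ω, q (g • ω) = g • q ω) {S : Set Ω} (hS : S.Finite)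
    (hqS : S.InjOn q) (hfin : ∀ s ∈ S, (orbit G (q s)).Finite) :
    ∃ ρ : G →* Equiv.Perm Ω, (jointSupport ρ).Finite ∧ AgreeOn (toPermHom G Ω) ρ S := by
  let T : SubMulAction G Θ :=
    { carrier := ⋃ s ∈ S, orbit G (q s)
      smul_mem' g t ht := by
        obtain ⟨s, hs, ht⟩ := Set.mem_iUnion₂.1 ht
        exact Set.mem_biUnion hs (mem_orbit_of_mem_orbit g ht) }
  have := (hS.biUnion hfin : (T : Set Θ).Finite).to_subtype
  have exists_lift (t : T) : ∃ ω, q ω = t ∧ ∀ s ∈ S, q s = t → ω = s := by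
    by_cases h : ∃ s ∈ S, q s = t
    · obtain ⟨s, hs, hst⟩ := h
      exact ⟨s, hst, fun s' hs' hst' => hqS hs hs' (hst.trans hst'.symm)⟩
    · obtain ⟨s, -, g, hg⟩ := Set.mem_iUnion₂.1 t.2
      exact ⟨g • s, (hq g s).trans hg, fun s' hs' hst' => absurd ⟨s', hs', hst'⟩ h⟩
  choose σ hσ hσS using exists_lift
  have σ_injective : σ.Injective := fun t t' h => Subtype.ext (by rw [← hσ t, ← hσ t', h])
  refine ⟨(Equiv.Perm.viaEmbeddingHom ⟨σ, σ_injective⟩).comp (toPermHom G T),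
    (Set.finite_range σ).subset ?_, fun g s hs hgs => ?_⟩
  · rintro ω ⟨g, hg⟩
    by_contra hω
    exact hg (Equiv.Perm.viaEmbedding_apply_of_notMem _ _ _ hω)
  · let t : T := ⟨q s, Set.mem_biUnion hs (mem_orbit_self _)⟩
    calc _ = Equiv.Perm.viaEmbedding (toPermHom G T g) ⟨σ, σ_injective⟩ (σ t) := by
          rw [hσS t s hs rfl]; rfl
      _ = σ (g • t) := Equiv.Perm.viaEmbedding_apply _ ⟨σ, σ_injective⟩ t
      _ = g • s := hσS _ _ hgs (hq g s)

theorem exists_normal_finiteIndex_notMem_orbit [MulAction G Ω] {s : Ω}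
    (hs : IsClosed[profiniteTopology G] (stabilizer G s : Set G)) {s' : Ω} (hne : s ≠ s') :
    ∃ N : Subgroup G, N.Normal ∧ N.FiniteIndex ∧ s' ∉ orbit N s := by
  by_cases h : s' ∈ orbit G s
  · obtain ⟨a, rfl⟩ := h
    have ha : a⁻¹ ∈ (stabilizer G s : Set G)ᶜ := fun h => hne (inv_mem_iff.1 h).symm
    obtain ⟨N, hN, hN', hNs⟩ := exists_normal_mul_mem_of_isOpen hs.isOpen_compl ha
    refine ⟨N, hN, hN', ?_⟩
    rintro ⟨n, hn⟩
    refine hNs n n.2 ?_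
    change (a⁻¹ * (n : G)) • s = s
    rw [mul_smul, inv_smul_eq_iff]
    exact hn
  · refine ⟨⊤, inferInstance, inferInstance, ?_⟩
    rintro ⟨n, hn⟩
    exact h ⟨n, hn⟩

theorem exists_normal_finiteIndex_injOn_orbit [MulAction G Ω]
    (hcl : ∀ ω : Ω, IsClosed[profiniteTopology G] (stabilizer G ω : Set G)) {S : Set Ω}
    (hS : S.Finite) :
    ∃ N : Subgroup G, N.Normal ∧ N.FiniteIndex ∧ S.InjOn fun s => orbit N s := by
  have := hS.to_subtype
  choose N hN hN' hNs using fun t : {t : S × S // t.1 ≠ t.2} =>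
    exists_normal_finiteIndex_notMem_orbit (hcl t.1.1) (Subtype.coe_ne_coe.2 t.2)
  refine ⟨⨅ t, N t, Subgroup.normal_iInf_normal hN, Subgroup.finiteIndex_iInf hN', ?_⟩
  intro s hs s' hs' hss'
  by_contra hne
  let t : {t : S × S // t.1 ≠ t.2} := ⟨(⟨s, hs⟩, ⟨s', hs'⟩), fun h => hne (congrArg Subtype.val h)⟩
  obtain ⟨n, hn⟩ : s' ∈ orbit (⨅ t, N t : Subgroup G) s := orbit_eq_iff.1 hss'.symm
  exact hNs t ⟨⟨n, (Subgroup.mem_iInf.1 n.2) t⟩, hn⟩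

theorem exists_finite_jointSupport_agreeOn {τ : G →* Equiv.Perm Ω}
    (hcl : ∀ ω, IsClosed[profiniteTopology G] (pointStabilizer τ ω : Set G)) {S : Set Ω}
    (hS : S.Finite) : ∃ ρ : G →* Equiv.Perm Ω, (jointSupport ρ).Finite ∧ AgreeOn τ ρ S := by
  let := compHom Ω τ
  obtain ⟨N, hN, hN', hNS⟩ := exists_normal_finiteIndex_injOn_orbit hcl hS
  refine exists_finite_jointSupport_of_injOn (q := fun ω => orbit N ω)
    (fun g ω => (smul_orbit_eq_orbit_smul N ω g).symm) hS hNS fun s _ => ?_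
  have hle : N ≤ stabilizer G (orbit N s) := fun n hn => smul_orbit (⟨n, hn⟩ : N) s
  have := Subgroup.finiteIndex_of_le hle
  exact Set.finite_coe_iff.1 (Finite.of_equiv _ (orbitEquivQuotientStabilizer G (orbit N s)).symm)

end PermutationActions

section FreeProductActions

open Monoid Monoid.Coprod MulAction

variable {G₁ G₂ Ω : Type*} [Group G₁] [Group G₂]

theorem exists_finite_forall_agreeOn_lift_apply_eq (τ : Coprod G₁ G₂ →* Equiv.Perm Ω)
    (x : Coprod G₁ G₂) (p : Ω) : ∃ S : Set Ω, S.Finite ∧ ∀ ρ₁ ρ₂,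
      AgreeOn (τ.comp inl) ρ₁ S → AgreeOn (τ.comp inr) ρ₂ S → lift ρ₁ ρ₂ x p = τ x p := by
  induction x using Coprod.induction_on generalizing p with
  | inl a => exact ⟨{p, τ (inl a) p}, by simp, fun ρ₁ ρ₂ h _ => h a p (.inl rfl) (.inr rfl)⟩
  | inr b => exact ⟨{p, τ (inr b) p}, by simp, fun ρ₁ ρ₂ _ h => h b p (.inl rfl) (.inr rfl)⟩
  | mul x y hx hy =>
    obtain ⟨S, hS, hyS⟩ := hy p
    obtain ⟨T, hT, hxT⟩ := hx (τ y p)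
    refine ⟨S ∪ T, hS.union hT, fun ρ₁ ρ₂ h₁ h₂ => ?_⟩
    rw [map_mul, map_mul, Equiv.Perm.mul_apply, Equiv.Perm.mul_apply,
      hyS ρ₁ ρ₂ (h₁.mono Set.subset_union_left) (h₂.mono Set.subset_union_left),
      hxT ρ₁ ρ₂ (h₁.mono Set.subset_union_right) (h₂.mono Set.subset_union_right)]

theorem jointSupport_lift_subset (ρ₁ : G₁ →* Equiv.Perm Ω) (ρ₂ : G₂ →* Equiv.Perm Ω) :
    jointSupport (lift ρ₁ ρ₂) ⊆ jointSupport ρ₁ ∪ jointSupport ρ₂ := by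
  rintro ω ⟨x, hω⟩
  contrapose hω
  have fixed₁ (a : G₁) : ρ₁ a ω = ω := by_contra fun h => hω (.inl ⟨a, h⟩)
  have fixed₂ (b : G₂) : ρ₂ b ω = ω := by_contra fun h => hω (.inr ⟨b, h⟩)
  induction x using Coprod.induction_on with
  | inl a => rw [lift_apply_inl, fixed₁]
  | inr b => rw [lift_apply_inr, fixed₂]
  | mul x y hx hy => rw [map_mul, Equiv.Perm.mul_apply, hy, hx]

/-- Since the factors are free, their actions can be replaced, independently of each other, by
actions moving finitely many points and agreeing with `τ` on a given finite set. -/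
theorem isClosed_pointStabilizer_coprod {τ : Coprod G₁ G₂ →* Equiv.Perm Ω} {p : Ω}
    (hfg : (pointStabilizer τ p).FG)
    (h₁ : ∀ ω, IsClosed[profiniteTopology G₁] (pointStabilizer (τ.comp inl) ω : Set G₁))
    (h₂ : ∀ ω, IsClosed[profiniteTopology G₂] (pointStabilizer (τ.comp inr) ω : Set G₂)) :
    IsClosed[profiniteTopology (Coprod G₁ G₂)] (pointStabilizer τ p : Set (Coprod G₁ G₂)) := by
  refine isClosed_profiniteTopology_of_forall_notMem fun g hg => ?_
  obtain ⟨F, hF, hFfin⟩ := (Subgroup.fg_iff _).1 hfg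
  choose S hS hτS using fun x => exists_finite_forall_agreeOn_lift_apply_eq τ x p
  have hSfin : (⋃ x ∈ insert g F, S x).Finite := (hFfin.insert g).biUnion fun x _ => hS x
  obtain ⟨ρ₁, hρ₁, hτρ₁⟩ := exists_finite_jointSupport_agreeOn h₁ hSfin
  obtain ⟨ρ₂, hρ₂, hτρ₂⟩ := exists_finite_jointSupport_agreeOn h₂ hSfin
  have lift_apply {x : Coprod G₁ G₂} (hx : x ∈ insert g F) : lift ρ₁ ρ₂ x p = τ x p :=
    hτS x ρ₁ ρ₂ (hτρ₁.mono (Set.subset_biUnion_of_mem hx))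
      (hτρ₂.mono (Set.subset_biUnion_of_mem hx))
  refine ⟨pointStabilizer (lift ρ₁ ρ₂) p, finiteIndex_pointStabilizer
    ((hρ₁.union hρ₂).subset (jointSupport_lift_subset ρ₁ ρ₂)) p, ?_, fun h => hg ?_⟩
  · rw [← hF, Subgroup.closure_le]
    intro x hx
    have hxτ : x ∈ pointStabilizer τ p := hF ▸ Subgroup.subset_closure hx
    exact (lift_apply (.inr hx)).trans hxτ
  · exact (lift_apply (.inl rfl)).symm.trans h

theorem pointStabilizer_toPermHom_comp_mk {G K : Type*} [Group G] [Group K] (H : Subgroup G)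
    (φ : K →* G) (w : G) :
    pointStabilizer ((toPermHom G (G ⧸ H)).comp φ) (w : G ⧸ H) =
      (MulAut.conj w • H).comap φ := by
  ext k
  rw [mem_pointStabilizer, Subgroup.mem_comap, Subgroup.mem_pointwise_smul_iff_inv_smul_mem,
    ← map_inv, MulAut.smul_def, MulAut.conj_apply, inv_inv, mul_assoc, ← QuotientGroup.eq, eq_comm]
  rfl

theorem isClosed_of_isClosed_comap_conj {H : Subgroup (Coprod G₁ G₂)} (hH : H.FG)
    (h₁ : ∀ w : Coprod G₁ G₂,
      IsClosed[profiniteTopology G₁] ((MulAut.conj w • H).comap inl : Set G₁))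
    (h₂ : ∀ w : Coprod G₁ G₂,
      IsClosed[profiniteTopology G₂] ((MulAut.conj w • H).comap inr : Set G₂)) :
    IsClosed[profiniteTopology (Coprod G₁ G₂)] (H : Set (Coprod G₁ G₂)) := by
  have hstab : pointStabilizer (toPermHom _ (Coprod G₁ G₂ ⧸ H)) (1 : Coprod G₁ G₂) = H :=
    stabilizer_quotient H
  rw [← hstab]
  refine isClosed_pointStabilizer_coprod (by rwa [hstab]) ?_ ?_ <;>
    refine QuotientGroup.mk_surjective.forall.2 fun w => ?_ <;>
    rw [pointStabilizer_toPermHom_comp_mk]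
  exacts [h₁ w, h₂ w]

end FreeProductActions

theorem theorem1p5 {G₁ G₂ : Type*} [Group G₁] [Group G₂]
    (h₁ : IsGFERFHyperbolicGroup G₁) (h₂ : IsGFERFHyperbolicGroup G₂) :
    IsGFERFHyperbolicGroup (Monoid.Coprod G₁ G₂) := by
  obtain ⟨hyp₁, closed₁⟩ := h₁
  obtain ⟨hyp₂, closed₂⟩ := h₂
  obtain ⟨A₁, hA₁, δ₁, hδ₁⟩ := isHyperbolicGroup_iff.1 hyp₁
  obtain ⟨A₂, hA₂, δ₂, hδ₂⟩ := isHyperbolicGroup_iff.1 hyp₂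
  have hB := hA₁.coprod hA₂
  have hδ := hA₁.isGromovHyperbolic_coprodGenSet hA₂ (hδ₁.mono (le_max_left δ₁ δ₂))
    (hδ₂.mono (le_max_right δ₁ δ₂))
  refine ⟨isHyperbolicGroup_iff.2 ⟨_, hB, _, hδ⟩, ?_⟩
  rintro H ⟨A, hA, hH⟩
  refine isClosed_of_isClosed_comap_conj (hH.fg hA) (fun w => ?_) fun w => ?_
  · exact closed₁ _ ⟨A₁, hA₁, (hH.conj hA hB hδ w).comap hA₁ hB (hA₁.wordDist_inl hA₂)⟩
  · exact closed₂ _ ⟨A₂, hA₂, (hH.conj hA hB hδ w).comap hA₂ hB (hA₁.wordDist_inr hA₂)⟩
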